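/- Let $n$ be a positive integer and write $[m]=\{1,2,\dots,m\}$ (so $[0]=\emptyset$). A (1,2)-configuration of $[m]$ is a set $x$ of pairwise disjoint subsets of $[m]$, each of cardinality $1$ (a ball) or $2$ (an arc); not every element of $[m]$ has to be covered. It is noncrossing if it contains no arcs $\{i_1,j_1\}$ and $\{i_2,j_2\}$ with $i_1<i_2<j_1<j_2$. Let $X_n$ be the (finite) set of all noncrossing (1,2)-configurations of $[n-1]$. For $x=\{\{a_1,b_1\},\dots,\{a_\ell,b_\ell\},\{c_1\},\dots,\{c_s\}\}\in X_n$, with arcs $\{a_i,b_i\}$ and balls $\{c_j\}$, put $$\mathrm{cwt}(x)=\sum_{i=1}^{\ell}(a_i+b_i)+2\sum_{j=1}^{s}c_j .$$ Let $q$ be an indeterminate, and let $[m]_q=1+q+\cdots+q^{m-1}$, $[m]!_q=[m]_q[m-1]_q\cdots[1]_q$ and $\begin{bmatrix} m\\ k\end{bmatrix}_q=\dfrac{[m]!_q}{[k]!_q\,[m-k]!_q}$ for $0\le k\le m$. Then, for every positive integer $n$, $$\sum_{x\in X_n}q^{\mathrm{cwt}(x)}=\frac{1}{[n+1]_q}\begin{bmatrix}2n\\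 n\end{bmatrix}_q ,$$ that is, the generating function of $\mathrm{cwt}$ over $X_n$ is MacMahon's $q$-Catalan number $\mathrm{Cat}_n(q)$. -/

import Mathlib

/-- A (1,2)-configuration of `[m] = {1, …, m}`: a set of pairwise disjoint balls (one-element
subsets of `[m]`) and arcs (two-element subsets of `[m]`). -/
structure IsConfiguration (m : ℕ) (x : Finset (Finset ℕ)) : Prop where
  subset : ∀ A ∈ x, A ⊆ Finset.Icc 1 m
  card : ∀ A ∈ x, A.card = 1 ∨ A.card = 2
  disjoint : ∀ A ∈ x, ∀ B ∈ x, A ≠ B → Disjoint A B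

/-- There are no arcs `{i₁, j₁}` and `{i₂, j₂}` with `i₁ < i₂ < j₁ < j₂`
(these inequalities force both sets to have two elements). -/
def IsNoncrossing (x : Finset (Finset ℕ)) : Prop :=
  ∀ i₁ j₁ i₂ j₂ : ℕ, {i₁, j₁} ∈ x → {i₂, j₂} ∈ x → ¬ (i₁ < i₂ ∧ i₂ < j₁ ∧ j₁ < j₂)

open Classical in
/-- The finite set `X_n` of all noncrossing (1,2)-configurations of `[n - 1]` (for `n ≥ 1`).
The ambient double power set only serves to make it a `Finset`. -/
noncomputable def noncrossingConfigurations (n : ℕ) : Finset (Finset (Finset ℕ)) :=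
  (Finset.Icc 1 (n - 1)).powerset.powerset.filter
    fun x => IsConfiguration (n - 1) x ∧ IsNoncrossing x

/-- Membership in `X_n` is exactly being a noncrossing (1,2)-configuration of `[n - 1]`. -/
theorem mem_noncrossingConfigurations {n : ℕ} {x : Finset (Finset ℕ)} :
    x ∈ noncrossingConfigurations n ↔ IsConfiguration (n - 1) x ∧ IsNoncrossing x := by
  classical
  simp only [noncrossingConfigurations, Finset.mem_filter, Finset.mem_powerset]
  exact ⟨fun h => h.2, fun h => ⟨fun A hA => Finset.mem_powerset.2 (h.1.subset A hA), h⟩⟩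

/-- `cwt x`: the sum of the endpoints of all arcs of `x`, plus twice the sum of the positions of
all balls of `x`. -/
def cwt (x : Finset (Finset ℕ)) : ℕ :=
  (∑ A ∈ x with A.card = 2, ∑ a ∈ A, a) + 2 * ∑ A ∈ x with A.card = 1, ∑ c ∈ A, c

section QAnalogues

variable {K : Type*} [Field K]

/-- `[n]_q = 1 + q + ⋯ + q ^ (n - 1)`. -/
def qNumber (q : K) (n : ℕ) : K := ∑ i ∈ Finset.range n, q ^ i

/-- `[n]!_q = [1]_q [2]_q ⋯ [n]_q`. -/
def qFactorial (q : K) (n : ℕ) : K := ∏ i ∈ Finset.Icc 1 n, qNumber q i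

/-- The `q`-binomial coefficient `[n]!_q / ([k]!_q [n - k]!_q)`, for `k ≤ n`. -/
def qBinomial (q : K) (n k : ℕ) : K :=
  qFactorial q n / (qFactorial q k * qFactorial q (n - k))

/-- MacMahon's `q`-Catalan number `(1 / [n + 1]_q) * [2n choose n]_q`. -/
def qCatalan (q : K) (n : ℕ) : K := 1 / qNumber q (n + 1) * qBinomial q (2 * n) n

end QAnalogues

/-!
The generating function is computed by scanning a configuration from left to right. After the
points `1, …, m`, what has been seen is a noncrossing configuration of `[m]` together with a set of
`h` open half-arcs, whose right endpoints are still to come (`IsPartialConfiguration`). Since the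
final configuration has no crossing, no open half-arc lies below an arc, and the next arc to close
must close the last open half-arc. So the point `m + 1` is uncovered, is a ball, opens a half-arc,
or closes the last open one, and the generating functions `P m h` (`partialSum`) satisfy

  `P (m + 1) h = (1 + q ^ (2 (m + 1))) P m h + q ^ (m + 1) (P m (h - 1) + P m (h + 1))`

with `P m (-1) = 0`: an arc contributes its two endpoints to the weight separately, so each
endpoint can be paid for when it is scanned.

This recursion has the closed solution

  `P m h = q ^ (h (h + 1) / 2) [2m + 2]! [h + 1] / ([m + 1] [m + h + 2]! [m - h]!)`

(`qBallot`). By `invQFactorial_sub_one` all reciprocal factorials in the recursion are multiples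
of two of them, so the recursion reduces to a polynomial identity in `q`, `q ^ m` and `q ^ h`. At
`m = n - 1` and `h = 0` the closed form is the `q`-Catalan number.
-/

/-! ### Partial configurations -/

/-- A partial configuration of `[m]` with `h` open half-arcs: a noncrossing (1,2)-configuration `x`
of `[m]` together with a set `S` of `h` uncovered points, none of which lies below an arc of `x`.
The points of `S` are the left endpoints of arcs whose right endpoint is still to come. -/
structure IsPartialConfiguration (m h : ℕ) (x : Finset (Finset ℕ)) (S : Finset ℕ) : Prop where
  config : IsConfiguration m x
  noncrossing : IsNoncrossing x
  subset_Icc : S ⊆ Finset.Icc 1 m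
  card_eq : S.card = h
  notMem : ∀ A ∈ x, ∀ s ∈ S, s ∉ A
  visible : ∀ i j, {i, j} ∈ x → ∀ s ∈ S, ¬ (i < s ∧ s < j)

open Classical in
/-- The finite set of partial configurations of `[m]` with `h` open half-arcs. -/
noncomputable def partialConfigurations (m h : ℕ) : Finset (Finset (Finset ℕ) × Finset ℕ) :=
  ((Finset.Icc 1 m).powerset.powerset ×ˢ (Finset.Icc 1 m).powerset).filter
    fun p => IsPartialConfiguration m h p.1 p.2

theorem mem_partialConfigurations {m h : ℕ} {p : Finset (Finset ℕ) × Finset ℕ} :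
    p ∈ partialConfigurations m h ↔ IsPartialConfiguration m h p.1 p.2 := by
  classical
  simp only [partialConfigurations, Finset.mem_filter, Finset.mem_product, Finset.mem_powerset]
  exact ⟨fun h => h.2, fun h =>
    ⟨⟨fun A hA => Finset.mem_powerset.2 (h.config.subset A hA), h.subset_Icc⟩, h⟩⟩

/-- The weight of a partial configuration: an open half-arc at `s` contributes `s`, its share of
the weight of the arc it will become. -/
def partialWeight (p : Finset (Finset ℕ) × Finset ℕ) : ℕ :=
  cwt p.1 + ∑ s ∈ p.2, s

theorem cwt_insert_of_card_eq_one {x : Finset (Finset ℕ)} {A : Finset ℕ} (hA : A ∉ x)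
    (h : A.card = 1) : cwt (insert A x) = cwt x + 2 * ∑ a ∈ A, a := by
  have : A ∉ x.filter fun B => B.card = 1 := fun h' => hA (Finset.mem_filter.1 h').1
  simp [cwt, Finset.filter_insert, h, Finset.sum_insert this]
  ring

theorem cwt_insert_of_card_eq_two {x : Finset (Finset ℕ)} {A : Finset ℕ} (hA : A ∉ x)
    (h : A.card = 2) : cwt (insert A x) = cwt x + ∑ a ∈ A, a := by
  have : A ∉ x.filter fun B => B.card = 2 := fun h' => hA (Finset.mem_filter.1 h').1
  simp [cwt, Finset.filter_insert, h, Finset.sum_insert this]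
  ring

theorem Finset.pair_eq_pair_of_lt {i j a b : ℕ} (hij : i < j) (hab : a < b)
    (h : ({i, j} : Finset ℕ) = {a, b}) : i = a ∧ j = b := by
  have h1 : i ∈ ({a, b} : Finset ℕ) := h ▸ by simp
  have h2 : j ∈ ({a, b} : Finset ℕ) := h ▸ by simp
  have h3 : a ∈ ({i, j} : Finset ℕ) := h ▸ by simp
  simp only [Finset.mem_insert, Finset.mem_singleton] at h1 h2 h3
  omega

namespace IsConfiguration

variable {m : ℕ} {x : Finset (Finset ℕ)} {A B : Finset ℕ}

theorem le (hx : IsConfiguration m x) (hA : A ∈ x) {a : ℕ} (ha : a ∈ A) : a ≤ m :=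
  (Finset.mem_Icc.1 (hx.subset A hA ha)).2

theorem eq_of_mem (hx : IsConfiguration m x) (hA : A ∈ x) (hB : B ∈ x) {a : ℕ} (ha : a ∈ A)
    (hb : a ∈ B) : A = B :=
  by_contra fun h => Finset.disjoint_left.1 (hx.disjoint A hA B hB h) ha hb

theorem succ (hx : IsConfiguration m x) : IsConfiguration (m + 1) x :=
  ⟨fun A hA => (hx.subset A hA).trans (Finset.Icc_subset_Icc_right m.le_succ), hx.card,
    hx.disjoint⟩

theorem mono {y : Finset (Finset ℕ)} (hx : IsConfiguration m x) (h : y ⊆ x) :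
    IsConfiguration m y :=
  ⟨fun A hA => hx.subset A (h hA), fun A hA => hx.card A (h hA),
    fun A hA B hB => hx.disjoint A (h hA) B (h hB)⟩

theorem of_succ (hx : IsConfiguration (m + 1) x) (h : ∀ A ∈ x, m + 1 ∉ A) :
    IsConfiguration m x := by
  refine ⟨fun A hA a ha => ?_, hx.card, hx.disjoint⟩
  have h1 := Finset.mem_Icc.1 (hx.subset A hA ha)
  have h2 : a ≠ m + 1 := fun e => h A hA (e ▸ ha)
  exact Finset.mem_Icc.2 ⟨h1.1, by omega⟩

theorem erase (hx : IsConfiguration (m + 1) x) (hA : A ∈ x) (hm : m + 1 ∈ A) :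
    IsConfiguration m (x.erase A) :=
  (hx.mono (Finset.erase_subset A x)).of_succ fun _ hB hmB =>
    (Finset.mem_erase.1 hB).1 (hx.eq_of_mem (Finset.mem_erase.1 hB).2 hA hmB hm)

theorem insert (hx : IsConfiguration m x) (hA : A ⊆ Finset.Icc 1 m)
    (hc : A.card = 1 ∨ A.card = 2) (hd : ∀ B ∈ x, Disjoint A B) :
    IsConfiguration m (insert A x) := by
  refine ⟨fun B hB => ?_, fun B hB => ?_, fun B hB C hC hne => ?_⟩
  · rcases Finset.mem_insert.1 hB with rfl | hB
    exacts [hA, hx.subset B hB]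
  · rcases Finset.mem_insert.1 hB with rfl | hB
    exacts [hc, hx.card B hB]
  · rcases Finset.mem_insert.1 hB with rfl | hB' <;>
      rcases Finset.mem_insert.1 hC with rfl | hC'
    exacts [absurd rfl hne, hd C hC', (hd B hB').symm, hx.disjoint B hB' C hC' hne]

end IsConfiguration

theorem IsNoncrossing.mono {x y : Finset (Finset ℕ)} (hx : IsNoncrossing x) (h : y ⊆ x) :
    IsNoncrossing y :=
  fun i₁ j₁ i₂ j₂ h₁ h₂ => hx i₁ j₁ i₂ j₂ (h h₁) (h h₂)

namespace IsPartialConfiguration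

variable {m h : ℕ} {x : Finset (Finset ℕ)} {S : Finset ℕ}

theorem le (hp : IsPartialConfiguration m h x S) {s : ℕ} (hs : s ∈ S) : s ≤ m :=
  (Finset.mem_Icc.1 (hp.subset_Icc hs)).2

theorem succ_notMem (hp : IsPartialConfiguration m h x S) {A : Finset ℕ} (hA : A ∈ x) :
    m + 1 ∉ A := fun ha => by have := hp.config.le hA ha; omega

theorem notMem_of_succ_mem (hp : IsPartialConfiguration m h x S) {A : Finset ℕ}
    (ha : m + 1 ∈ A) : A ∉ x := fun hA => hp.succ_notMem hA ha

theorem succ_notMem_right (hp : IsPartialConfiguration m h x S) : m + 1 ∉ S :=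
  fun hs => by have := hp.le hs; omega

theorem succ (hp : IsPartialConfiguration m h x S) : IsPartialConfiguration (m + 1) h x S :=
  ⟨hp.config.succ, hp.noncrossing, hp.subset_Icc.trans (Finset.Icc_subset_Icc_right m.le_succ),
    hp.card_eq, hp.notMem, hp.visible⟩

theorem subset_Icc_of_succ (hp : IsPartialConfiguration (m + 1) h x S) (hm : m + 1 ∉ S) :
    S ⊆ Finset.Icc 1 m := fun a ha => by
  have h1 := Finset.mem_Icc.1 (hp.subset_Icc ha)
  have h2 : a ≠ m + 1 := fun e => hm (e ▸ ha)
  exact Finset.mem_Icc.2 ⟨h1.1, by omega⟩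

theorem of_succ (hp : IsPartialConfiguration (m + 1) h x S) (hx : ∀ A ∈ x, m + 1 ∉ A)
    (hS : m + 1 ∉ S) : IsPartialConfiguration m h x S :=
  ⟨hp.config.of_succ hx, hp.noncrossing, hp.subset_Icc_of_succ hS, hp.card_eq, hp.notMem,
    hp.visible⟩

/-- Adding a ball at `m + 1`. -/
theorem insert_ball (hp : IsPartialConfiguration m h x S) :
    IsPartialConfiguration (m + 1) h (insert {m + 1} x) S := by
  have key : ∀ i j, i < j → {i, j} ∈ insert {m + 1} x → {i, j} ∈ x := by
    intro i j hij hmem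
    refine (Finset.mem_insert.1 hmem).resolve_left fun e => ?_
    have h1 : i ∈ ({m + 1} : Finset ℕ) := e ▸ by simp
    have h2 : j ∈ ({m + 1} : Finset ℕ) := e ▸ by simp
    simp only [Finset.mem_singleton] at h1 h2
    omega
  refine ⟨hp.config.succ.insert (by simp) (by simp) fun B hB => ?_, ?_, hp.succ.subset_Icc,
    hp.card_eq, ?_, ?_⟩
  · exact Finset.disjoint_singleton_left.2 (hp.succ_notMem hB)
  · intro i₁ j₁ i₂ j₂ h₁ h₂ hlt
    exact hp.noncrossing i₁ j₁ i₂ j₂ (key _ _ (by omega) h₁) (key _ _ (by omega) h₂) hlt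
  · intro A hA s hs
    rcases Finset.mem_insert.1 hA with rfl | hA
    · have := hp.le hs
      simp only [Finset.mem_singleton]
      omega
    · exact hp.notMem A hA s hs
  · intro i j hij s hs hlt
    exact hp.visible i j (key _ _ (by omega) hij) s hs hlt

theorem erase_ball (hp : IsPartialConfiguration (m + 1) h x S) (hb : {m + 1} ∈ x) :
    IsPartialConfiguration m h (x.erase {m + 1}) S :=
  ⟨hp.config.erase hb (by simp), hp.noncrossing.mono (Finset.erase_subset _ _),
    hp.subset_Icc_of_succ fun hs => hp.notMem _ hb _ hs (by simp), hp.card_eq,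
    fun A hA => hp.notMem A (Finset.mem_of_mem_erase hA),
    fun i j hij => hp.visible i j (Finset.mem_of_mem_erase hij)⟩

/-- Opening a half-arc at `m + 1`. -/
theorem insert_open (hp : IsPartialConfiguration m h x S) :
    IsPartialConfiguration (m + 1) (h + 1) x (insert (m + 1) S) := by
  refine ⟨hp.config.succ, hp.noncrossing, ?_, ?_, ?_, ?_⟩
  · exact Finset.insert_subset (by simp) hp.succ.subset_Icc
  · rw [Finset.card_insert_of_notMem hp.succ_notMem_right, hp.card_eq]
  · intro A hA s hs
    rcases Finset.mem_insert.1 hs with rfl | hs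
    exacts [hp.succ_notMem hA, hp.notMem A hA s hs]
  · intro i j hij s hs hlt
    rcases Finset.mem_insert.1 hs with rfl | hs
    · have := hp.config.le hij (a := j) (by simp)
      omega
    · exact hp.visible i j hij s hs hlt

theorem erase_open (hp : IsPartialConfiguration (m + 1) (h + 1) x S) (hs : m + 1 ∈ S) :
    IsPartialConfiguration m h x (S.erase (m + 1)) := by
  refine ⟨hp.config.of_succ fun A hA => hp.notMem A hA _ hs, hp.noncrossing, ?_, ?_,
    fun A hA s hs => hp.notMem A hA s (Finset.mem_of_mem_erase hs),
    fun i j hij s hs => hp.visible i j hij s (Finset.mem_of_mem_erase hs)⟩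
  · intro a ha
    have h1 := Finset.mem_Icc.1 (hp.subset_Icc (Finset.mem_of_mem_erase ha))
    have h2 := Finset.ne_of_mem_erase ha
    exact Finset.mem_Icc.2 ⟨h1.1, by omega⟩
  · rw [Finset.card_erase_of_mem hs, hp.card_eq]; rfl

/-- Closing the last open half-arc by an arc ending at `m + 1`. Closing any other one would put an
open half-arc below the new arc. -/
theorem close (hp : IsPartialConfiguration m (h + 1) x S) {a : ℕ} (ha : a ∈ S)
    (hmax : ∀ s ∈ S, s ≤ a) :
    IsPartialConfiguration (m + 1) h (insert {a, m + 1} x) (S.erase a) := by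
  have ham := hp.le ha
  have ha1 := (Finset.mem_Icc.1 (hp.subset_Icc ha)).1
  have key : ∀ i j, i < j → {i, j} ∈ insert {a, m + 1} x →
      (i = a ∧ j = m + 1) ∨ ({i, j} ∈ x ∧ j ≤ m) := by
    intro i j hij hmem
    rcases Finset.mem_insert.1 hmem with e | hmem
    · exact Or.inl (Finset.pair_eq_pair_of_lt hij (by omega) e)
    · exact Or.inr ⟨hmem, hp.config.le hmem (by simp)⟩
  refine ⟨hp.config.succ.insert ?_ (Or.inr (Finset.card_pair (by omega))) fun B hB => ?_, ?_,
    (Finset.erase_subset a S).trans hp.succ.subset_Icc, ?_, ?_, ?_⟩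
  · intro b hb
    simp only [Finset.mem_insert, Finset.mem_singleton] at hb
    exact Finset.mem_Icc.2 (by omega)
  · rw [Finset.disjoint_insert_left, Finset.disjoint_singleton_left]
    exact ⟨hp.notMem B hB a ha, hp.succ_notMem hB⟩
  · intro i₁ j₁ i₂ j₂ h₁ h₂ hlt
    rcases key i₁ j₁ (by omega) h₁ with ⟨e, e'⟩ | ⟨h₁, hj₁⟩ <;>
      rcases key i₂ j₂ (by omega) h₂ with ⟨f, f'⟩ | ⟨h₂, hj₂⟩
    · omega
    · omega
    · exact hp.visible i₁ j₁ h₁ a ha (by omega)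
    · exact hp.noncrossing i₁ j₁ i₂ j₂ h₁ h₂ hlt
  · rw [Finset.card_erase_of_mem ha, hp.card_eq]; rfl
  · intro A hA s hs
    have hs' := Finset.mem_of_mem_erase hs
    rcases Finset.mem_insert.1 hA with rfl | hA
    · have h1 := hp.le hs'
      have h2 := Finset.ne_of_mem_erase hs
      simp only [Finset.mem_insert, Finset.mem_singleton]
      omega
    · exact hp.notMem A hA s hs'
  · intro i j hij s hs hlt
    have hs' := Finset.mem_of_mem_erase hs
    rcases key i j (by omega) hij with ⟨e, e'⟩ | ⟨hij, -⟩
    · have := hmax s hs'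
      omega
    · exact hp.visible i j hij s hs' hlt

/-- Reopening the arc `{a, m + 1}`; its left endpoint becomes the last open half-arc. -/
theorem reopen (hp : IsPartialConfiguration (m + 1) h x S) {a : ℕ} (ha : a ≤ m)
    (hA : {a, m + 1} ∈ x) :
    IsPartialConfiguration m (h + 1) (x.erase {a, m + 1}) (insert a S) ∧ a ∉ S ∧
      ∀ s ∈ insert a S, s ≤ a := by
  have haS : a ∉ S := fun hs => hp.notMem _ hA a hs (by simp)
  have hmS : m + 1 ∉ S := fun hs => hp.notMem _ hA _ hs (by simp)
  have ha1 := (Finset.mem_Icc.1 (hp.config.subset _ hA (by simp : a ∈ _))).1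
  have hS := hp.subset_Icc_of_succ hmS
  have hcfg := hp.config.erase hA (by simp)
  refine ⟨⟨hcfg, hp.noncrossing.mono (Finset.erase_subset _ _),
    Finset.insert_subset (Finset.mem_Icc.2 ⟨ha1, ha⟩) hS, ?_, ?_, ?_⟩, haS, ?_⟩
  · rw [Finset.card_insert_of_notMem haS, hp.card_eq]
  · intro A hA' s hs hsA
    have hA'' := Finset.mem_of_mem_erase hA'
    rcases Finset.mem_insert.1 hs with rfl | hs
    · exact Finset.ne_of_mem_erase hA' (hp.config.eq_of_mem hA'' hA hsA (by simp))
    · exact hp.notMem A hA'' s hs hsA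
  · intro i j hij s hs hlt
    have hij' := Finset.mem_of_mem_erase hij
    rcases Finset.mem_insert.1 hs with rfl | hs
    · have := hcfg.le hij (a := j) (by simp)
      exact hp.noncrossing i j s (m + 1) hij' hA (by omega)
    · exact hp.visible i j hij' s hs hlt
  · intro s hs
    rcases Finset.mem_insert.1 hs with rfl | hs
    · exact le_rfl
    · have h1 := (Finset.mem_Icc.1 (hS hs)).2
      by_contra hlt
      exact hp.visible a (m + 1) hA s hs (by omega)

/-- A block covering `m + 1` that is not a ball is an arc ending there. -/
theorem exists_arc (hp : IsPartialConfiguration (m + 1) h x S) (hb : {m + 1} ∉ x)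
    (hx : ¬ ∀ A ∈ x, m + 1 ∉ A) : ∃ a ≤ m, {a, m + 1} ∈ x := by
  push Not at hx
  obtain ⟨A, hA, hmA⟩ := hx
  rcases hp.config.card A hA with hc | hc
  · obtain ⟨b, rfl⟩ := Finset.card_eq_one.1 hc
    rw [Finset.mem_singleton.1 hmA] at hb
    exact absurd hA hb
  · obtain ⟨b, c, hbc, rfl⟩ := Finset.card_eq_two.1 hc
    have h1 := hp.config.le hA (a := b) (by simp)
    have h2 := hp.config.le hA (a := c) (by simp)
    simp only [Finset.mem_insert, Finset.mem_singleton] at hmA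
    rcases hmA with rfl | rfl
    · exact ⟨c, by omega, Finset.pair_comm c (m + 1) ▸ hA⟩
    · exact ⟨b, by omega, hA⟩

end IsPartialConfiguration

/-! ### Generating functions and their recursion -/

section GeneratingFunction

variable {K : Type*} [Field K]

/-- The generating function of partial configurations of `[m]` with `h` open half-arcs. -/
noncomputable def partialSum (q : K) (m h : ℕ) : K :=
  ∑ p ∈ partialConfigurations m h, q ^ partialWeight p

variable (q : K) (m h : ℕ)

/-- Partial configurations that leave `m + 1` uncovered. -/
theorem sum_uncovered :
    ∑ p ∈ partialConfigurations (m + 1) h with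
        ¬ (m + 1 ∈ p.2) ∧ ¬ ({m + 1} ∈ p.1) ∧ ∀ A ∈ p.1, m + 1 ∉ A, q ^ partialWeight p =
      partialSum q m h := by
  refine Finset.sum_congr (Finset.ext fun p => ?_) fun _ _ => rfl
  simp only [Finset.mem_filter, mem_partialConfigurations]
  exact ⟨fun hp => hp.1.of_succ hp.2.2.2 hp.2.1, fun hp => ⟨hp.succ, hp.succ_notMem_right,
    hp.notMem_of_succ_mem (by simp), fun A hA => hp.succ_notMem hA⟩⟩

/-- Partial configurations with a ball at `m + 1`. -/
theorem sum_ball :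
    ∑ p ∈ partialConfigurations (m + 1) h with ¬ (m + 1 ∈ p.2) ∧ {m + 1} ∈ p.1,
        q ^ partialWeight p =
      q ^ (2 * (m + 1)) * partialSum q m h := by
  rw [partialSum, Finset.mul_sum]
  symm
  refine Finset.sum_nbij' (fun p => (insert {m + 1} p.1, p.2)) (fun p => (p.1.erase {m + 1}, p.2))
    ?_ ?_ ?_ ?_ ?_ <;> simp only [Finset.mem_filter, mem_partialConfigurations]
  · exact fun p hp => ⟨hp.insert_ball, hp.succ_notMem_right, Finset.mem_insert_self _ _⟩
  · exact fun p hp => hp.1.erase_ball hp.2.2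
  · exact fun p hp => Prod.ext (Finset.erase_insert (hp.notMem_of_succ_mem (by simp))) rfl
  · exact fun p hp => Prod.ext (Finset.insert_erase hp.2.2) rfl
  · intro p hp
    rw [← pow_add, partialWeight, partialWeight,
      cwt_insert_of_card_eq_one (hp.notMem_of_succ_mem (by simp)) (by simp), Finset.sum_singleton]
    congr 1
    ring

/-- Partial configurations with an open half-arc at `m + 1`. -/
theorem sum_open :
    ∑ p ∈ partialConfigurations (m + 1) (h + 1) with m + 1 ∈ p.2, q ^ partialWeight p =
      q ^ (m + 1) * partialSum q m h := by
  rw [partialSum, Finset.mul_sum]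
  symm
  refine Finset.sum_nbij' (fun p => (p.1, insert (m + 1) p.2)) (fun p => (p.1, p.2.erase (m + 1)))
    ?_ ?_ ?_ ?_ ?_ <;> simp only [Finset.mem_filter, mem_partialConfigurations]
  · exact fun p hp => ⟨hp.insert_open, Finset.mem_insert_self _ _⟩
  · exact fun p hp => hp.1.erase_open hp.2
  · exact fun p hp => Prod.ext rfl (Finset.erase_insert hp.succ_notMem_right)
  · exact fun p hp => Prod.ext rfl (Finset.insert_erase hp.2)
  · intro p hp
    rw [← pow_add, partialWeight, partialWeight, Finset.sum_insert hp.succ_notMem_right]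
    congr 1
    ring

theorem sum_open_zero :
    ∑ p ∈ partialConfigurations (m + 1) 0 with m + 1 ∈ p.2, q ^ partialWeight p = 0 := by
  refine Finset.sum_eq_zero fun p hp => ?_
  rw [Finset.mem_filter, mem_partialConfigurations] at hp
  rw [Finset.card_eq_zero.1 hp.1.card_eq] at hp
  exact absurd hp.2 (Finset.notMem_empty _)

theorem exists_max_of_card_eq_succ {S : Finset ℕ} (hS : S.card = h + 1) :
    S.sup id ∈ S ∧ ∀ s ∈ S, s ≤ S.sup id := by
  have hne : S.Nonempty := Finset.card_pos.1 (by omega)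
  obtain ⟨a, ha, e⟩ := Finset.exists_mem_eq_sup S hne id
  exact ⟨by rw [e]; exact ha, fun s hs => Finset.le_sup (f := id) hs⟩

/-- Partial configurations with an arc ending at `m + 1`. They arise from those of `[m]` with one
more open half-arc, by closing the last of these. -/
theorem sum_close :
    ∑ p ∈ partialConfigurations (m + 1) h with
        ¬ (m + 1 ∈ p.2) ∧ ¬ ({m + 1} ∈ p.1) ∧ ¬ ∀ A ∈ p.1, m + 1 ∉ A, q ^ partialWeight p =
      q ^ (m + 1) * partialSum q m (h + 1) := by
  rw [partialSum, Finset.mul_sum]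
  symm
  refine Finset.sum_nbij
    (fun p => (insert {p.2.sup id, m + 1} p.1, p.2.erase (p.2.sup id))) ?_ ?_ ?_ ?_
  · intro p hp
    rw [mem_partialConfigurations] at hp
    obtain ⟨ha, hmax⟩ := exists_max_of_card_eq_succ h hp.card_eq
    have ham := hp.le ha
    have hc := hp.close ha hmax
    simp only [Finset.mem_filter, mem_partialConfigurations]
    refine ⟨hc, fun hs => hp.succ_notMem_right (Finset.mem_of_mem_erase hs), fun hb => ?_,
      fun hx => hx _ (Finset.mem_insert_self _ _) (by simp)⟩
    have e := hc.config.eq_of_mem hb (Finset.mem_insert_self _ _) (a := m + 1) (by simp) (by simp)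
    have h1 : p.2.sup id ∈ ({m + 1} : Finset ℕ) := by rw [e]; simp
    rw [Finset.mem_singleton] at h1
    omega
  · intro p hp p' hp' e
    rw [Finset.mem_coe, mem_partialConfigurations] at hp hp'
    obtain ⟨ha, hmax⟩ := exists_max_of_card_eq_succ h hp.card_eq
    obtain ⟨ha', hmax'⟩ := exists_max_of_card_eq_succ h hp'.card_eq
    have ham := hp.le ha
    have ham' := hp'.le ha'
    obtain ⟨e1, e2⟩ := Prod.ext_iff.1 e
    simp only at e1 e2
    have hc := (hp'.close ha' hmax').config
    -- the arc covering `m + 1` determines the point that was closed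
    have e3 : ({p.2.sup id, m + 1} : Finset ℕ) = {p'.2.sup id, m + 1} :=
      hc.eq_of_mem (by rw [← e1]; exact Finset.mem_insert_self _ _) (Finset.mem_insert_self _ _)
        (a := m + 1) (by simp) (by simp)
    have e4 := (Finset.pair_eq_pair_of_lt (by omega) (by omega) e3).1
    refine Prod.ext ?_ ?_
    · rw [← Finset.erase_insert (hp.notMem_of_succ_mem (A := {p.2.sup id, m + 1}) (by simp)), e1,
        e3, Finset.erase_insert (hp'.notMem_of_succ_mem (by simp))]
    · rw [← Finset.insert_erase ha, e2, e4, Finset.insert_erase ha']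
  · intro p hp
    simp only [Finset.coe_filter, Set.mem_ofPred_eq, mem_partialConfigurations] at hp
    obtain ⟨hp, -, hb, hx⟩ := hp
    obtain ⟨a, ham, hA⟩ := hp.exists_arc hb hx
    obtain ⟨hr, haS, hmax⟩ := hp.reopen ham hA
    have hsup : (insert a p.2).sup id = a :=
      le_antisymm (Finset.sup_le hmax) (Finset.le_sup (f := id) (Finset.mem_insert_self a p.2))
    refine ⟨(p.1.erase {a, m + 1}, insert a p.2), ?_, ?_⟩
    · rw [Finset.mem_coe, mem_partialConfigurations]
      exact hr
    · simp only [hsup]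
      exact Prod.ext (Finset.insert_erase hA) (Finset.erase_insert haS)
  · intro p hp
    rw [mem_partialConfigurations] at hp
    obtain ⟨ha, hmax⟩ := exists_max_of_card_eq_succ h hp.card_eq
    have hne : p.2.sup id ≠ m + 1 := by have := hp.le ha; omega
    have hsum := Finset.add_sum_erase p.2 (fun s => s) ha
    rw [← pow_add, partialWeight, partialWeight,
      cwt_insert_of_card_eq_two (hp.notMem_of_succ_mem (by simp)) (Finset.card_pair hne),
      Finset.sum_pair hne]
    congr 1
    simp only at hsum ⊢
    omega

/-- The recursion at the last point `m + 1`, with the contribution of the configurations that open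
a half-arc there left unevaluated, since it depends on whether `h = 0`. -/
theorem partialSum_succ_aux :
    partialSum q (m + 1) h =
      ∑ p ∈ partialConfigurations (m + 1) h with m + 1 ∈ p.2, q ^ partialWeight p +
        ((1 + q ^ (2 * (m + 1))) * partialSum q m h + q ^ (m + 1) * partialSum q m (h + 1)) := by
  rw [partialSum, ← Finset.sum_filter_add_sum_filter_not _ (fun p => m + 1 ∈ p.2)]
  congr 1
  rw [← Finset.sum_filter_add_sum_filter_not _ (fun p => {m + 1} ∈ p.1), Finset.filter_filter,
    Finset.filter_filter, sum_ball]
  rw [← Finset.sum_filter_add_sum_filter_not _ (fun p => ∀ A ∈ p.1, m + 1 ∉ A),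
    Finset.filter_filter, Finset.filter_filter]
  simp only [and_assoc]
  rw [sum_uncovered, sum_close]
  ring

theorem partialSum_succ_zero :
    partialSum q (m + 1) 0 =
      (1 + q ^ (2 * (m + 1))) * partialSum q m 0 + q ^ (m + 1) * partialSum q m 1 := by
  rw [partialSum_succ_aux, sum_open_zero, zero_add]

theorem partialSum_succ_succ :
    partialSum q (m + 1) (h + 1) =
      (1 + q ^ (2 * (m + 1))) * partialSum q m (h + 1) +
        q ^ (m + 1) * (partialSum q m h + partialSum q m (h + 2)) := by
  rw [partialSum_succ_aux, sum_open]
  ring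

theorem partialSum_zero_left : partialSum q 0 h = if h = 0 then 1 else 0 := by
  have key : ∀ p ∈ partialConfigurations 0 h, p = (∅, ∅) ∧ h = 0 := by
    intro p hp
    rw [mem_partialConfigurations] at hp
    have hS : p.2 = ∅ := Finset.subset_empty.1 hp.subset_Icc
    refine ⟨Prod.ext (Finset.eq_empty_of_forall_notMem fun A hA => ?_) hS, ?_⟩
    · have hA0 : A = ∅ := Finset.subset_empty.1 (hp.config.subset A hA)
      have := hp.config.card A hA
      simp [hA0] at this
    · rw [← hp.card_eq, hS, Finset.card_empty]
  split_ifs with h0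
  · subst h0
    have : partialConfigurations 0 0 = {(∅, ∅)} := by
      refine Finset.eq_singleton_iff_unique_mem.2 ⟨?_, fun p hp => (key p hp).1⟩
      rw [mem_partialConfigurations]
      constructor <;> simp [IsNoncrossing]
      constructor <;> simp
    simp [partialSum, this, partialWeight, cwt]
  · exact Finset.sum_eq_zero fun p hp => absurd (key p hp).2 h0

theorem sum_noncrossingConfigurations (n : ℕ) :
    ∑ x ∈ noncrossingConfigurations n, q ^ cwt x = partialSum q (n - 1) 0 := by
  refine Finset.sum_nbij' (fun x => (x, ∅)) Prod.fst ?_ ?_ ?_ ?_ ?_ <;>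
    simp only [mem_noncrossingConfigurations, mem_partialConfigurations]
  · exact fun x hx => ⟨hx.1, hx.2, by simp, rfl, by simp, by simp⟩
  · exact fun p hp => ⟨hp.config, hp.noncrossing⟩
  · simp
  · exact fun p hp => Prod.ext rfl (Finset.card_eq_zero.1 hp.card_eq).symm
  · exact fun x _ => by simp [partialWeight]

end GeneratingFunction

/-! ### The closed form -/

section ClosedForm

variable {K : Type*} [Field K]

/-- The reciprocal `q`-factorial `1 / [k]!_q`, extended by `0` to negative integers `k`. With this
convention `invQFactorial_sub_one` holds at every integer. -/
def invQFactorial (q : K) (k : ℤ) : K :=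
  if 0 ≤ k then 1 / qFactorial q k.toNat else 0

theorem qFactorial_succ (q : K) (n : ℕ) :
    qFactorial q (n + 1) = qFactorial q n * qNumber q (n + 1) := by
  rw [qFactorial, qFactorial, Finset.prod_Icc_succ_top (by omega)]

theorem qNumber_mul_one_sub (q : K) (n : ℕ) : qNumber q n * (1 - q) = 1 - q ^ n :=
  geom_sum_mul_neg q n

theorem qNumber_ne_zero {q : K} (hq : ∀ k : ℕ, 1 ≤ k → q ^ k ≠ 1) {n : ℕ} (hn : 1 ≤ n) :
    qNumber q n ≠ 0 := by
  intro h
  have := qNumber_mul_one_sub q n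
  rw [h, zero_mul] at this
  exact hq n hn (sub_eq_zero.1 this.symm).symm

theorem qFactorial_ne_zero {q : K} (hq : ∀ k : ℕ, 1 ≤ k → q ^ k ≠ 1) (n : ℕ) :
    qFactorial q n ≠ 0 :=
  Finset.prod_ne_zero_iff.2 fun _ hi => qNumber_ne_zero hq (Finset.mem_Icc.1 hi).1

theorem invQFactorial_natCast (q : K) (n : ℕ) : invQFactorial q n = 1 / qFactorial q n := by
  simp [invQFactorial]

theorem invQFactorial_of_neg (q : K) {k : ℤ} (hk : k < 0) : invQFactorial q k = 0 :=
  if_neg (not_le.2 hk)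

theorem invQFactorial_sub_one {q : K} (hq : ∀ k : ℕ, 1 ≤ k → q ^ k ≠ 1) (k : ℤ) :
    (1 - q) * invQFactorial q (k - 1) = (1 - q ^ k) * invQFactorial q k := by
  rcases lt_trichotomy k 0 with hk | rfl | hk
  · rw [invQFactorial_of_neg q hk, invQFactorial_of_neg q (by omega)]; simp
  · rw [invQFactorial_of_neg q (by omega)]; simp
  · obtain ⟨n, rfl⟩ : ∃ n : ℕ, k = (n + 1 : ℕ) := ⟨(k - 1).toNat, by omega⟩
    rw [show ((n + 1 : ℕ) : ℤ) - 1 = (n : ℕ) by push_cast; ring, invQFactorial_natCast,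
      invQFactorial_natCast, qFactorial_succ, zpow_natCast, ← qNumber_mul_one_sub]
    have h1 := qFactorial_ne_zero hq n
    have h2 := qNumber_ne_zero hq (Nat.le_add_left 1 n)
    field_simp

/-- The generating function of partial configurations of `[m]` with `h` open half-arcs in closed
form, `q ^ (h (h + 1) / 2) [2m + 2]! [h + 1] / ([m + 1] [m + h + 2]! [m - h]!)`, a `q`-ballot
number. It vanishes for `h > m` because `invQFactorial` does at negative integers. -/
def qBallot (q : K) (m h : ℕ) : K :=
  q ^ ((h + 1).choose 2) * (1 - q ^ (h + 1)) *
    (qFactorial q (2 * m + 2) / (qNumber q (m + 1) * (1 - q))) *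
    (invQFactorial q (m + h + 2) * invQFactorial q (m - h))

theorem qBallot_zero_left {q : K} (hq : ∀ k : ℕ, 1 ≤ k → q ^ k ≠ 1) (h : ℕ) :
    qBallot q 0 h = if h = 0 then 1 else 0 := by
  split_ifs with h0
  · subst h0
    have h1 := qFactorial_ne_zero hq 2
    have h2 : 1 - q ≠ 0 := fun e => hq 1 le_rfl (by rw [pow_one]; exact (sub_eq_zero.1 e).symm)
    have e2 : invQFactorial q 2 = 1 / qFactorial q 2 := invQFactorial_natCast q 2
    have e0 : invQFactorial q 0 = 1 / qFactorial q 0 := invQFactorial_natCast q 0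
    simp [qBallot, e2, e0, qNumber, qFactorial] at h1 ⊢
    field_simp
  · rw [qBallot, invQFactorial_of_neg q (k := ((0 : ℕ) : ℤ) - h) (by push_cast; omega)]
    simp

/-- Ratio of consecutive values of the factor of `qBallot` that does not depend on `h`. -/
theorem qBallot_factor_succ {q : K} (hq : ∀ k : ℕ, 1 ≤ k → q ^ k ≠ 1) (m : ℕ) :
    qFactorial q (2 * (m + 1) + 2) / (qNumber q (m + 1 + 1) * (1 - q)) * (1 - q) ^ 2 =
      (1 + q ^ (m + 2)) * (1 - q ^ (m + 1)) * (1 - q ^ (2 * m + 3)) *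
        (qFactorial q (2 * m + 2) / (qNumber q (m + 1) * (1 - q))) := by
  have h0 : 1 - q ≠ 0 := fun e => hq 1 le_rfl (by rw [pow_one]; exact (sub_eq_zero.1 e).symm)
  have h1 := qNumber_ne_zero hq (Nat.le_add_left 1 m)
  have h2 := qNumber_ne_zero hq (Nat.le_add_left 1 (m + 1))
  have e3 := qNumber_mul_one_sub q (2 * m + 3)
  have e1 := qNumber_mul_one_sub q (m + 1)
  have e4 : qNumber q (2 * m + 4) = (1 + q ^ (m + 2)) * qNumber q (m + 1 + 1) := by
    apply mul_right_cancel₀ h0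
    rw [mul_assoc, qNumber_mul_one_sub, qNumber_mul_one_sub]; ring
  rw [show 2 * (m + 1) + 2 = 2 * m + 2 + 1 + 1 by ring, qFactorial_succ, qFactorial_succ,
    show 2 * m + 2 + 1 + 1 = 2 * m + 4 by ring, show 2 * m + 2 + 1 = 2 * m + 3 by ring, e4,
    ← e3, ← e1]
  field_simp

theorem qBallot_succ_zero {q : K} (q0 : q ≠ 0) (hq : ∀ k : ℕ, 1 ≤ k → q ^ k ≠ 1) (m : ℕ) :
    qBallot q (m + 1) 0 =
      (1 + q ^ (2 * (m + 1))) * qBallot q m 0 + q ^ (m + 1) * qBallot q m 1 := by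
  have h0 : 1 - q ≠ 0 := fun e => hq 1 le_rfl (by rw [pow_one]; exact (sub_eq_zero.1 e).symm)
  have hc := qBallot_factor_succ hq m
  have r1 := invQFactorial_sub_one hq (m + 3)
  have s1 := invQFactorial_sub_one hq (m + 1)
  have s0 := invQFactorial_sub_one hq m
  simp only [qBallot, Nat.cast_add, Nat.cast_zero, Nat.cast_one] at hc ⊢
  rw [show ((m : ℤ) + 3 - 1) = m + 2 by ring] at r1
  rw [show ((m : ℤ) + 1 - 1) = m by ring] at s1
  rw [show ((m : ℤ) + 1 + 0 + 2) = m + 3 by ring, show ((m : ℤ) + 0 + 2) = m + 2 by ring,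
    show ((m : ℤ) + 1 + 2) = m + 3 by ring, sub_zero, sub_zero]
  generalize qFactorial q (2 * (m + 1) + 2) / (qNumber q (m + 1 + 1) * (1 - q)) = c' at *
  generalize qFactorial q (2 * m + 2) / (qNumber q (m + 1) * (1 - q)) = c at *
  generalize invQFactorial q ((m : ℤ) + 3) = R at *
  generalize invQFactorial q ((m : ℤ) + 2) = R' at *
  generalize invQFactorial q ((m : ℤ) + 1) = S at *
  generalize invQFactorial q ((m : ℤ) - 1) = S'' at *
  generalize invQFactorial q (m : ℤ) = S' at *
  have z1 : q ^ ((m : ℤ) + 1) = q ^ m * q := by rw [zpow_add₀ q0]; simp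
  have z3 : q ^ ((m : ℤ) + 3) = q ^ m * q ^ 3 := by rw [zpow_add₀ q0]; norm_cast
  rw [z1] at s1; rw [z3] at r1; rw [zpow_natCast] at s0
  rw [show q ^ (m + 2) = q ^ m * q ^ 2 by ring, show q ^ (m + 1) = q ^ m * q by ring,
    show q ^ (2 * m + 3) = (q ^ m) ^ 2 * q ^ 3 by ring] at hc
  rw [show q ^ (m + 1) = q ^ m * q by ring, show q ^ (2 * (m + 1)) = (q ^ m) ^ 2 * q ^ 2 by ring]
  generalize q ^ m = x at *
  -- in terms of `R`, `S` and `x = q ^ m` the claim is a polynomial identity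
  apply mul_right_cancel₀ (pow_ne_zero 2 h0)
  rw [show Nat.choose (0 + 1) 2 = 0 from rfl, show Nat.choose (1 + 1) 2 = 1 from rfl]
  linear_combination (1 - q) * R * S * hc
    - (1 + x ^ 2 * q ^ 2) * (1 - q) * c * ((1 - q) * S' * r1 + (1 - x * q ^ 3) * R * s1)
    - x * q * q * (1 - q ^ 2) * c * R * ((1 - q) * s0 + (1 - x) * s1)

theorem qBallot_succ_succ {q : K} (q0 : q ≠ 0) (hq : ∀ k : ℕ, 1 ≤ k → q ^ k ≠ 1) (m h : ℕ) :
    qBallot q (m + 1) (h + 1) =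
      (1 + q ^ (2 * (m + 1))) * qBallot q m (h + 1) +
        q ^ (m + 1) * (qBallot q m h + qBallot q m (h + 2)) := by
  have h0 : 1 - q ≠ 0 := fun e => hq 1 le_rfl (by rw [pow_one]; exact (sub_eq_zero.1 e).symm)
  have hc := qBallot_factor_succ hq m
  have r1 := invQFactorial_sub_one hq (m + h + 4)
  have r0 := invQFactorial_sub_one hq (m + h + 3)
  have s1 := invQFactorial_sub_one hq (m - h)
  have s0 := invQFactorial_sub_one hq (m - h - 1)
  simp only [qBallot, Nat.cast_add, Nat.cast_one, Nat.cast_ofNat] at hc ⊢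
  rw [show ((m : ℤ) + h + 4 - 1) = m + h + 3 by ring] at r1
  rw [show ((m : ℤ) + h + 3 - 1) = m + h + 2 by ring] at r0
  rw [show ((m : ℤ) - h - 1 - 1) = m - h - 2 by ring] at s0
  rw [show ((m : ℤ) + 1 + (h + 1) + 2) = m + h + 4 by ring,
    show ((m : ℤ) + (h + 1) + 2) = m + h + 3 by ring,
    show ((m : ℤ) + (h + 2) + 2) = m + h + 4 by ring,
    show ((m : ℤ) + 1 - (h + 1)) = m - h by ring,
    show ((m : ℤ) - (h + 1)) = m - h - 1 by ring,
    show ((m : ℤ) - (h + 2)) = m - h - 2 by ring]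
  generalize qFactorial q (2 * (m + 1) + 2) / (qNumber q (m + 1 + 1) * (1 - q)) = c' at *
  generalize qFactorial q (2 * m + 2) / (qNumber q (m + 1) * (1 - q)) = c at *
  generalize invQFactorial q ((m : ℤ) + h + 4) = R at *
  generalize invQFactorial q ((m : ℤ) + h + 3) = R' at *
  generalize invQFactorial q ((m : ℤ) + h + 2) = R'' at *
  generalize invQFactorial q ((m : ℤ) - h - 2) = S'' at *
  generalize invQFactorial q ((m : ℤ) - h - 1) = S' at *
  generalize invQFactorial q ((m : ℤ) - h) = S at *
  have hh : q ^ h ≠ 0 := pow_ne_zero h q0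
  have z4 : q ^ ((m : ℤ) + h + 4) = q ^ m * q ^ h * q ^ 4 := by
    rw [zpow_add₀ q0, zpow_add₀ q0]; norm_cast
  have z3 : q ^ ((m : ℤ) + h + 3) = q ^ m * q ^ h * q ^ 3 := by
    rw [zpow_add₀ q0, zpow_add₀ q0]; norm_cast
  have y1 : q ^ ((m : ℤ) - h) = q ^ m * (q ^ h)⁻¹ := by
    rw [zpow_sub₀ q0, div_eq_mul_inv]; norm_cast
  have y0 : q ^ ((m : ℤ) - h - 1) = q ^ m * (q ^ h)⁻¹ * q⁻¹ := by
    rw [zpow_sub₀ q0, zpow_sub₀ q0, div_eq_mul_inv, div_eq_mul_inv]; simp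
  rw [y1] at s1; rw [y0] at s0; rw [z4] at r1; rw [z3] at r0
  have t1 : (h + 1 + 1).choose 2 = (h + 1).choose 2 + (h + 1) := by
    rw [Nat.choose_succ_succ' (h + 1) 1, Nat.choose_one_right, add_comm]
  have t2 : (h + 2 + 1).choose 2 = (h + 1).choose 2 + (h + 1) + (h + 2) := by
    rw [Nat.choose_succ_succ' (h + 2) 1, Nat.choose_one_right, ← t1, add_comm]
  rw [t1, t2]
  rw [show q ^ (m + 2) = q ^ m * q ^ 2 by ring, show q ^ (m + 1) = q ^ m * q by ring,
    show q ^ (2 * m + 3) = (q ^ m) ^ 2 * q ^ 3 by ring] at hc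
  rw [show q ^ (m + 1) = q ^ m * q by ring, show q ^ (2 * (m + 1)) = (q ^ m) ^ 2 * q ^ 2 by ring,
    show q ^ (h + 1 + 1) = q ^ h * q ^ 2 by ring, show q ^ (h + 2 + 1) = q ^ h * q ^ 3 by ring]
  simp only [pow_add _ _ (h + 1), pow_add _ _ (h + 2)]
  rw [show q ^ (h + 1) = q ^ h * q by ring, show q ^ (h + 2) = q ^ h * q ^ 2 by ring]
  generalize q ^ ((h + 1).choose 2) = t at *
  generalize q ^ m = x at *
  generalize q ^ h = y at *
  have s1' : (1 - q) * y * S' = (y - x) * S := by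
    have : y * (1 - x * y⁻¹) = y - x := by field_simp
    linear_combination y * s1 + S * this
  have s0' : (1 - q) * (y * q) * S'' = (y * q - x) * S' := by
    have : y * q * (1 - x * y⁻¹ * q⁻¹) = y * q - x := by field_simp
    linear_combination y * q * s0 + S' * this
  -- in terms of `R`, `S`, `x = q ^ m`, `y = q ^ h` and `t` the claim is a polynomial identity
  apply mul_right_cancel₀ (pow_ne_zero 2 h0)
  linear_combination t * y * q * (1 - y * q ^ 2) * R * S * hc
    - (1 + x ^ 2 * q ^ 2) * t * q * (1 - y * q ^ 2) * c *
        ((1 - q) * y * S' * r1 + (1 - x * y * q ^ 4) * R * s1')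
    - x * q * t * (1 - y * q) * c * S * ((1 - q) * r0 + (1 - x * y * q ^ 3) * r1)
    - x * t * q ^ 3 * (1 - y * q ^ 3) * c * R * ((1 - q) * y * s0' + (y * q - x) * s1')

theorem qBallot_eq_qCatalan {q : K} (hq : ∀ k : ℕ, 1 ≤ k → q ^ k ≠ 1) (m : ℕ) :
    qBallot q m 0 = qCatalan q (m + 1) := by
  have h0 : 1 - q ≠ 0 := fun e => hq 1 le_rfl (by rw [pow_one]; exact (sub_eq_zero.1 e).symm)
  have e2 : invQFactorial q ((m : ℤ) + 2) = 1 / qFactorial q (m + 2) :=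
    invQFactorial_natCast q (m + 2)
  have h1 := qNumber_ne_zero hq (Nat.le_add_left 1 m)
  have h2 := qNumber_ne_zero hq (Nat.le_add_left 1 (m + 1))
  have h3 := qFactorial_ne_zero hq m
  rw [qCatalan, qBinomial, show 2 * (m + 1) - (m + 1) = m + 1 by omega]
  simp only [qBallot, Nat.cast_zero, add_zero, sub_zero,
    invQFactorial_natCast, e2, qFactorial_succ q m,
    show qFactorial q (m + 2) = _ from qFactorial_succ q (m + 1), zero_add,
    show 2 * (m + 1) = 2 * m + 2 by ring]
  simp
  field_simp

end ClosedForm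

theorem partialSum_eq_qBallot {K : Type*} [Field K] {q : K} (q0 : q ≠ 0)
    (hq : ∀ k : ℕ, 1 ≤ k → q ^ k ≠ 1) (m h : ℕ) : partialSum q m h = qBallot q m h := by
  induction m generalizing h with
  | zero => rw [partialSum_zero_left, qBallot_zero_left hq]
  | succ m ih =>
    cases h with
    | zero => rw [partialSum_succ_zero, qBallot_succ_zero q0 hq, ih, ih]
    | succ h => rw [partialSum_succ_succ, qBallot_succ_succ q0 hq, ih, ih, ih]

theorem ratFunc_X_pow_ne_one (k : ℕ) (hk : 1 ≤ k) : (RatFunc.X : RatFunc ℚ) ^ k ≠ 1 := by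
  intro h
  rw [← RatFunc.algebraMap_X, ← map_pow, ← map_one (algebraMap (Polynomial ℚ) (RatFunc ℚ))] at h
  have := congrArg Polynomial.natDegree (RatFunc.algebraMap_injective ℚ h)
  simp at this
  omega

/-- The identity is between rational functions in an indeterminate `q = RatFunc.X` over `ℚ`, where
no `q`-number `[m]_q` with `m ≥ 1` vanishes, so that the divisions are genuine. -/
theorem mainTheorem1 (n : ℕ) (hn : 1 ≤ n) :
    ∑ x ∈ noncrossingConfigurations n, (RatFunc.X : RatFunc ℚ) ^ cwt x =
      qCatalan (RatFunc.X : RatFunc ℚ) n := by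
  obtain ⟨m, rfl⟩ : ∃ m, n = m + 1 := ⟨n - 1, by omega⟩
  rw [sum_noncrossingConfigurations, Nat.add_sub_cancel,
    partialSum_eq_qBallot RatFunc.X_ne_zero ratFunc_X_pow_ne_one,
    qBallot_eq_qCatalan ratFunc_X_pow_ne_one]
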